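/- **Proposition 4.1.** Let $M$ be a connected $n$-dimensional affine manifold (without boundary), i.e. a manifold with an atlas modelled on $\mathbb{R}^n$ whose coordinate changes are locally restrictions of affine transformations of $\mathbb{R}^n$. Let $p:\hat M\to M$ be its universal covering, let $\pi_1(M)$ act on $\hat M$ by deck transformations, let $D:\hat M\to\mathbb{R}^n$ be a developing map (a map that near each point is the composition of an affine transformation of $\mathbb{R}^n$ with the lift of an affine chart of $M$), and let $h:\pi_1(M)\to \mathrm{Aff}(\mathbb{R}^n)$ be the holonomy, characterized by $D\circ\gamma=h(\gamma)\circ D$. Assume that $D$ is injective. Let $U\subset\mathbb{R}^n$ be a vector subspace of codimension $1$ such that the linear part of $h(\gamma)$ maps $U$ onto $U$ for every $\gamma\in\pi_1(M)$. Let $\hat{\mathcal F}$ be the foliation of $\hat M$ that is the pullback by $D$ of the foliation of $\mathbb{R}^n$ by the affine hyperplanes parallel to $U$, let $\mathcal F$ be the (linear) foliation of $M$ whose pullback by $p$ is $\hat{\mathcal F}$, and let $h_{\mathcal F}:\pi_1(M)\to\mathrm{Aff}(\mathbb{R}^n/U)$ be the global holonomy of $\mathcal F$, i.e. the representation induced by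 $h$ on the quotient. Suppose that $\mathcal F$ has a leaf $F_0$ whose fundamental group (for the leaf topology) is solvable, and that there is a leaf $\hat F_0$ of $\hat{\mathcal F}$ above $F_0$ (that is, $p(\hat F_0)=F_0$) such that $\gamma(\hat F_0)=\hat F_0$ for every $\gamma\in\ker h_{\mathcal F}$. Then $\pi_1(M)$ is solvable. -/

import Mathlib

open Filter Topology

namespace AffineFoliation

/-- The model space `ℝⁿ`. -/
abbrev E (n : ℕ) : Type := EuclideanSpace ℝ (Fin n)

/-- Maps of `ℝⁿ` which, near every point of `s`, agree with an affine transformation of `ℝⁿ`. -/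
def affinePregroupoid (n : ℕ) : Pregroupoid (E n) where
  property f s := ∀ x ∈ s, ∃ A : E n ≃ᵃ[ℝ] E n, f =ᶠ[𝓝 x] A
  comp := by
    intro f g u v hf hg hu hv huv x hx
    obtain ⟨A, hA⟩ := hf x hx.1
    obtain ⟨B, hB⟩ := hg (f x) hx.2
    refine ⟨A.trans B, ?_⟩
    have hcont : Tendsto f (𝓝 x) (𝓝 (f x)) := by
      have h1 : Tendsto A (𝓝 x) (𝓝 (A x)) :=
        (AffineMap.continuous_of_finiteDimensional (A : E n →ᵃ[ℝ] E n)).tendsto x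
      rw [hA.eq_of_nhds]
      exact h1.congr' hA.symm
    filter_upwards [hA, hcont.eventually hB] with y hy1 hy2
    rw [Function.comp_apply, hy2, hy1, AffineEquiv.trans_apply]
  id_mem := fun x _ => ⟨AffineEquiv.refl ℝ _, Eventually.of_forall fun _ => rfl⟩
  locality := by
    intro f u _ h x hx
    obtain ⟨v, _, hxv, hf⟩ := h x hx
    exact hf x ⟨hx, hxv⟩
  congr := by
    intro f g u hu hfg hf x hx
    obtain ⟨A, hA⟩ := hf x hx
    refine ⟨A, ?_⟩
    filter_upwards [hA, hu.mem_nhds hx] with y hy hyu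
    rw [hfg y hyu, hy]

/-- The structure groupoid of locally affine homeomorphisms between open subsets of `ℝⁿ`.
An `n`-dimensional affine manifold is a space `M` with `[ChartedSpace (E n) M]` and
`[HasGroupoid M (affineGroupoid n)]`: an atlas whose coordinate changes are (locally) affine. -/
def affineGroupoid (n : ℕ) : StructureGroupoid (E n) := (affinePregroupoid n).groupoid

/-- The group of deck transformations of `p`. When `p` is the universal covering of `M`, this is
the fundamental group of `M`, acting on the universal cover. -/
def deckGroup {Mhat M : Type*} [TopologicalSpace Mhat] (p : Mhat → M) :
    Subgroup (Mhat ≃ₜ Mhat) where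
  carrier := {γ | ∀ x, p (γ x) = p x}
  mul_mem' := by
    intro a b ha hb x
    rw [Homeomorph.mul_apply, ha, hb]
  one_mem' := fun _ => rfl
  inv_mem' := by
    intro a ha x
    have h := ha (a⁻¹ x)
    rw [← Homeomorph.mul_apply, mul_inv_cancel, Homeomorph.one_apply] at h
    exact h.symm

section Developing

variable {n : ℕ} {M Mhat : Type*} [TopologicalSpace M] [ChartedSpace (E n) M]
  [TopologicalSpace Mhat]

/-- `D : M̂ → ℝⁿ` is a developing map of the affine manifold `M` with covering `p : M̂ → M`: near
each point of `M̂`, it is an affine transformation of `ℝⁿ` composed with (the lift to `M̂` of) an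
affine chart of `M`. So `D` is a local diffeomorphism whose local restrictions are charts of the
affine structure which `M̂` inherits from `M`. -/
def IsDevelopingMap (p : Mhat → M) (D : Mhat → E n) : Prop :=
  ∀ x : Mhat, ∀ e ∈ atlas (E n) M, p x ∈ e.source →
    ∃ A : E n ≃ᵃ[ℝ] E n, D =ᶠ[𝓝 x] fun y => A (e (p y))

variable {p : Mhat → M} {D : Mhat → E n}

theorem IsDevelopingMap.map_nhds (hp : IsCoveringMap p) (hD : IsDevelopingMap p D) (x : Mhat) :
    map D (𝓝 x) = 𝓝 (D x) := by
  obtain ⟨A, hA⟩ := hD x (chartAt (E n) (p x)) (chart_mem_atlas _ _) (mem_chart_source _ _)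
  have hA1 : map A (𝓝 (chartAt (E n) (p x) (p x))) = 𝓝 (A (chartAt (E n) (p x) (p x))) :=
    A.toContinuousAffineEquiv.toHomeomorph.map_nhds_eq _
  rw [Filter.map_congr hA, hA.eq_of_nhds, ← hA1,
    ← (chartAt (E n) (p x)).map_nhds_eq (mem_chart_source _ _),
    ← hp.isLocalHomeomorph.map_nhds_eq x, Filter.map_map, Filter.map_map]
  rfl

/-- An affine transformation of `ℝⁿ` is determined by its germ at a point. -/
theorem affineEquiv_eq_of_eventuallyEq {A B : E n ≃ᵃ[ℝ] E n} {v : E n}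
    (h : ∀ᶠ y in 𝓝 v, A y = B y) : A = B := by
  obtain ⟨s, hs, hso, hvs⟩ := eventually_nhds_iff.1 h
  have hspan := hso.affineSpan_eq_top ⟨v, hvs⟩
  apply AffineEquiv.toAffineMap_injective
  exact AffineMap.ext_on hspan hs

theorem IsDevelopingMap.affine_unique (hp : IsCoveringMap p) (hD : IsDevelopingMap p D)
    {A B : E n ≃ᵃ[ℝ] E n} {x : Mhat} (h : ∀ᶠ y in 𝓝 x, A (D y) = B (D y)) : A = B := by
  apply affineEquiv_eq_of_eventuallyEq (v := D x)
  rw [← hD.map_nhds hp x]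
  exact h

/-- Along a connected `M̂`, every deck transformation is read through `D` as one affine
transformation of `ℝⁿ`. -/
theorem IsDevelopingMap.exists_holonomy [ConnectedSpace Mhat] (hp : IsCoveringMap p)
    (hD : IsDevelopingMap p D) (γ : deckGroup p) :
    ∃ A : E n ≃ᵃ[ℝ] E n, ∀ x, D (γ.1 x) = A (D x) := by
  have hloc : ∀ x : Mhat, ∃ A : E n ≃ᵃ[ℝ] E n, ∀ᶠ y in 𝓝 x, D (γ.1 y) = A (D y) := by
    intro x
    have hmem : p (γ.1 x) ∈ (chartAt (E n) (p x)).source := by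
      rw [γ.2 x]; exact mem_chart_source _ _
    obtain ⟨A, hA⟩ := hD x (chartAt (E n) (p x)) (chart_mem_atlas _ _) (mem_chart_source _ _)
    obtain ⟨B, hB⟩ := hD (γ.1 x) (chartAt (E n) (p x)) (chart_mem_atlas _ _) hmem
    refine ⟨A.symm.trans B, ?_⟩
    filter_upwards [hA, (γ.1.continuous.tendsto x).eventually hB] with y h1 h2
    rw [h2, h1, γ.2 y]
    simp
  obtain ⟨x₀⟩ : Nonempty Mhat := inferInstance
  obtain ⟨A, hA⟩ := hloc x₀
  have hclopen : IsClopen {x : Mhat | ∀ᶠ y in 𝓝 x, D (γ.1 y) = A (D y)} := by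
    refine ⟨?_, isOpen_setOfPred_eventually_nhds⟩
    rw [← closure_subset_iff_isClosed]
    intro x hx
    obtain ⟨B, hB⟩ := hloc x
    obtain ⟨z, hz1, hz2⟩ := mem_closure_iff_nhds.1 hx _ hB.eventually_nhds
    have hAB : A = B := by
      apply hD.affine_unique hp (x := z)
      filter_upwards [hz1, hz2] with y h1 h2
      rw [← h1, ← h2]
    rw [hAB]
    exact hB
  have huniv := hclopen.eq_univ ⟨x₀, hA⟩
  refine ⟨A, fun x => ?_⟩
  have hx : x ∈ {x : Mhat | ∀ᶠ y in 𝓝 x, D (γ.1 y) = A (D y)} := by rw [huniv]; trivial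
  exact mem_of_mem_nhds (s := {y | D (γ.1 y) = A (D y)}) hx

/-- The holonomy representation `h_M : π₁(M) → Aff(ℝⁿ)`: the unique one with
`D ∘ γ = h_M(γ) ∘ D` for all deck transformations `γ`. -/
noncomputable def holonomy [ConnectedSpace Mhat] (hp : IsCoveringMap p)
    (hD : IsDevelopingMap p D) : deckGroup p →* (E n ≃ᵃ[ℝ] E n) where
  toFun γ := (hD.exists_holonomy hp γ).choose
  map_one' := by
    obtain ⟨x₀⟩ : Nonempty Mhat := inferInstance
    apply hD.affine_unique hp (x := x₀)
    refine Eventually.of_forall fun y => ?_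
    rw [← (hD.exists_holonomy hp 1).choose_spec]
    rfl
  map_mul' := by
    intro a b
    obtain ⟨x₀⟩ : Nonempty Mhat := inferInstance
    apply hD.affine_unique hp (x := x₀)
    refine Eventually.of_forall fun y => ?_
    rw [AffineEquiv.mul_def, AffineEquiv.trans_apply,
      ← (hD.exists_holonomy hp (a * b)).choose_spec, ← (hD.exists_holonomy hp b).choose_spec,
      ← (hD.exists_holonomy hp a).choose_spec]
    rfl

theorem holonomy_spec [ConnectedSpace Mhat] (hp : IsCoveringMap p)
    (hD : IsDevelopingMap p D) (γ : deckGroup p) (x : Mhat) :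
    D (γ.1 x) = holonomy hp hD γ (D x) :=
  (hD.exists_holonomy hp γ).choose_spec x

end Developing

/-- The affine transformation of `ℝⁿ / U` induced by an affine transformation of `ℝⁿ` whose linear
part maps `U` onto `U`. -/
noncomputable def quotientAffineEquiv {n : ℕ} (U : Submodule ℝ (E n)) (A : E n ≃ᵃ[ℝ] E n)
    (hA : U.map (A.linear : E n →ₗ[ℝ] E n) = U) : (E n ⧸ U) ≃ᵃ[ℝ] (E n ⧸ U) :=
  (Submodule.Quotient.equiv U U A.linear hA).toAffineEquiv.trans
    (AffineEquiv.constVAdd ℝ (E n ⧸ U) (U.mkQ (A 0)))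

theorem quotientAffineEquiv_mkQ {n : ℕ} (U : Submodule ℝ (E n)) (A : E n ≃ᵃ[ℝ] E n)
    (hA : U.map (A.linear : E n →ₗ[ℝ] E n) = U) (v : E n) :
    quotientAffineEquiv U A hA (U.mkQ v) = U.mkQ (A v) := by
  have h : A v = A.linear v + A 0 := by
    have := A.map_vadd 0 v
    simpa using this
  rw [h, map_add, add_comm]
  simp [quotientAffineEquiv]

section Foliation

variable {n : ℕ} {M Mhat : Type*} [TopologicalSpace M] [ChartedSpace (E n) M]
  [TopologicalSpace Mhat] [ConnectedSpace Mhat] {p : Mhat → M} {D : Mhat → E n}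

/-- A linear foliation of the affine manifold `M` is given by a vector subspace `U` of `ℝⁿ` which
is invariant under the linear holonomy. -/
structure LinearFoliation (hp : IsCoveringMap p) (hD : IsDevelopingMap p D) where
  /-- the subspace `U` -/
  U : Submodule ℝ (E n)
  invariant : ∀ γ : deckGroup p, U.map ((holonomy hp hD γ).linear : E n →ₗ[ℝ] E n) = U

namespace LinearFoliation

variable {hp : IsCoveringMap p} {hD : IsDevelopingMap p D} (F : LinearFoliation hp hD)

/-- The codimension of the foliation is the dimension of `ℝⁿ / U`. -/
noncomputable def codim : ℕ := Module.finrank ℝ (E n ⧸ F.U)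

/-- The global holonomy `π₁(M) → Aff(ℝⁿ / U)` induced by the holonomy. -/
noncomputable def globalHolonomy : deckGroup p →* ((E n ⧸ F.U) ≃ᵃ[ℝ] (E n ⧸ F.U)) where
  toFun γ := quotientAffineEquiv F.U (holonomy hp hD γ) (F.invariant γ)
  map_one' := by
    ext q
    obtain ⟨v, rfl⟩ := F.U.mkQ_surjective q
    rw [quotientAffineEquiv_mkQ, map_one]
    rfl
  map_mul' := by
    intro a b
    ext q
    obtain ⟨v, rfl⟩ := F.U.mkQ_surjective q
    rw [AffineEquiv.mul_def, AffineEquiv.trans_apply, quotientAffineEquiv_mkQ,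
      quotientAffineEquiv_mkQ, quotientAffineEquiv_mkQ, map_mul]
    rfl

/-- The leaf topology on `M̂` of the pullback by `D` of the foliation of `ℝⁿ` by the affine
subspaces parallel to `U`: it is generated by the plaques `W ∩ D⁻¹(v + U)`, with `W` open in `M̂`,
that is, it is the coarsest topology which refines the one of `M̂` and makes the transverse
coordinate `M̂ → ℝⁿ → ℝⁿ / U` locally constant. -/
abbrev coverLeafTopology : TopologicalSpace Mhat :=
  (inferInstance : TopologicalSpace Mhat) ⊓
    TopologicalSpace.induced (fun x => F.U.mkQ (D x)) ⊥

/-- The leaf topology on `M` of the foliation whose pullback by `p` is the foliation of `M̂`: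
the quotient of the leaf topology on `M̂`, generated by the images of the plaques of `M̂`. -/
abbrev leafTopology : TopologicalSpace M :=
  TopologicalSpace.coinduced p F.coverLeafTopology

/-- The leaves of the foliation of `M̂`: the connected components for the leaf topology. -/
def IsCoverLeaf (L : Set Mhat) : Prop :=
  ∃ x : Mhat, L = @connectedComponent Mhat F.coverLeafTopology x

/-- The leaves of the foliation of `M`: the connected components for the leaf topology. -/
def IsLeaf (L : Set M) : Prop :=
  ∃ x : M, L = @connectedComponent M F.leafTopology x

/-- A leaf `L` of the foliation of `M`, as a space with its leaf topology (which is in general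
finer than the topology induced by `M`). -/
def Leaf (_ : LinearFoliation hp hD) (L : Set M) : Type _ := L

instance (L : Set M) : TopologicalSpace (F.Leaf L) :=
  TopologicalSpace.induced Subtype.val F.leafTopology

end LinearFoliation

end Foliation

end AffineFoliation

/-! The deck group, a copy of `π₁(M)` up to passing to the opposite group, is an extension of a
subgroup of `Aff(ℝⁿ / U)` by the kernel of the global holonomy. Since `ℝⁿ / U` is a line, its affine
group is solvable: translations are normal in it, with quotient the scalars.

The kernel is controlled by the leaf (`exists_leaf_loop`). If `γ` preserves `Fhat₀` and `a ∈ Fhat₀`,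
a leaf path from `a` to `γ a` projects to a loop in `F₀` with monodromy `γ`. So the kernel lies in
the image of `π₁(F₀)`, which is solvable; `π₁(F₀) → π₁(M)` need not be injective. Such paths exist
because an injective developing map is an open embedding, so leaves are locally joined by segments.
-/

/-- If every point can be joined to all nearby points, connected components are path connected. -/
theorem connectedComponent_subset_pathComponent {X : Type*} [TopologicalSpace X]
    (h : ∀ x : X, ∀ᶠ y in 𝓝 x, Joined x y) (x : X) :
    connectedComponent x ⊆ pathComponent x := by
  have hclopen : IsClopen (pathComponent x) := by
    refine ⟨⟨isOpen_iff_mem_nhds.2 fun y hy => ?_⟩, isOpen_iff_mem_nhds.2 fun y hy => ?_⟩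
    · filter_upwards [h y] with z hz hxz
      exact hy (hxz.trans hz.symm)
    · filter_upwards [h y] with z hz
      exact hy.trans hz
  exact hclopen.connectedComponent_subset (mem_pathComponent_self x)

/-- With `f` the transverse coordinate, this identifies neighbourhoods in the leaf topology with
plaques. -/
theorem nhds_inf_induced_bot {X Y : Type*} [t : TopologicalSpace X] (f : X → Y) (x : X) :
    @nhds X (t ⊓ .induced f ⊥) x = 𝓝 x ⊓ 𝓟 {y | f y = f x} := by
  let _ : TopologicalSpace Y := ⊥
  have : DiscreteTopology Y := ⟨rfl⟩
  rw [nhds_inf, nhds_induced, nhds_discrete Y, Filter.comap_pure]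
  rfl

/-- Needed because monodromy takes values in the opposite of the deck group. -/
theorem isSolvable_mulOpposite (G : Type*) [Group G] [Group.IsSolvable G] :
    Group.IsSolvable Gᵐᵒᵖ :=
  Group.isSolvable_of_surjective (f := (MulEquiv.inv' G).toMonoidHom) (MulEquiv.inv' G).surjective

/-- The affine group of a line is solvable. -/
theorem isSolvable_affineEquiv_of_finrank_eq_one {K V : Type*} [Field K] [AddCommGroup V]
    [Module K V] (hV : Module.finrank K V = 1) : Group.IsSolvable (V ≃ᵃ[K] V) := by
  obtain ⟨v, -, hv⟩ := finrank_eq_one_iff'.1 hV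
  have : Group.IsSolvable (V ≃ₗ[K] V) := by
    refine Group.isSolvable_of_comm fun f g => LinearEquiv.ext fun w => ?_
    obtain ⟨a, ha⟩ := hv (f v)
    obtain ⟨b, hb⟩ := hv (g v)
    obtain ⟨c, rfl⟩ := hv w
    simp only [LinearEquiv.mul_apply, map_smul, ← ha, ← hb]
    rw [smul_comm a b]
  -- The kernel of the linear part consists of translations, which commute.
  have : Group.IsSolvable (AffineEquiv.linearHom (k := K) (P₁ := V) (V₁ := V)).ker := by
    have translation (f : (AffineEquiv.linearHom (k := K) (P₁ := V) (V₁ := V)).ker) (w : V) :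
        f.1 w = w + f.1 0 := by
      have h0 : f.1.linear = LinearEquiv.refl K V := f.2
      simpa [h0] using f.1.map_vadd 0 w
    refine Group.isSolvable_of_comm fun f g => Subtype.ext (AffineEquiv.ext fun w => ?_)
    change f.1 (g.1 w) = g.1 (f.1 w)
    rw [translation f (g.1 w), translation g (f.1 w), translation f w, translation g w]
    abel
  exact Group.isSolvable_of_ker_le_range (Subgroup.subtype _) AffineEquiv.linearHom
    (Subgroup.range_subtype _).ge

namespace AffineFoliation

/-! ### Deck transformations of the universal covering -/

section Deck

variable {M Mhat : Type*} [TopologicalSpace M] [TopologicalSpace Mhat] {p : Mhat → M}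

instance deckGroupMulAction : MulAction (deckGroup p) Mhat where
  smul γ x := γ.1 x
  one_smul _ := rfl
  mul_smul _ _ _ := rfl

/-- A covering map from a connected space onto a connected space is surjective. -/
theorem surjective_of_isCoveringMap [PreconnectedSpace M] [Nonempty Mhat]
    (hp : IsCoveringMap p) : Function.Surjective p := by
  have hclopen : IsClopen (Set.range p) := by
    refine ⟨⟨isOpen_iff_mem_nhds.2 fun y hy => ?_⟩, hp.isOpenMap.isOpen_range⟩
    -- The model fibre is the fibre over `y` itself, so the second coordinate of a point over any `z
    -- ∈ U` is a point over `y`.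
    obtain ⟨-, U, hyU, hUo, -, H, hH⟩ := hp y
    filter_upwards [hUo.mem_nhds hyU]
    rintro _ hz ⟨e, rfl⟩
    exact hy ⟨(H ⟨e, hz⟩).2.1, (H ⟨e, hz⟩).2.2⟩
  exact Set.range_eq_univ.1 (hclopen.eq_univ (Set.range_nonempty p))

/-- The deck group of a universal covering acts transitively on the fibres. -/
theorem exists_deck_apply_eq [SimplyConnectedSpace Mhat] [LocallyPathConnectedSpace Mhat]
    (hp : IsCoveringMap p) {a b : Mhat} (hab : p a = p b) : ∃ γ : deckGroup p, γ.1 a = b := by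
  have lift {a b : Mhat} (hab : p a = p b) : ∃ f : C(Mhat, Mhat), f a = b ∧ p ∘ f = p :=
    (hp.existsUnique_continuousMap_lifts ⟨p, hp.continuous⟩ a b hab.symm).exists
  have inverse {a b : Mhat} {f g : C(Mhat, Mhat)} (hf : f a = b) (hpf : p ∘ f = p)
      (hg : g b = a) (hpg : p ∘ g = p) : g ∘ f = id :=
    -- Both `g ∘ f` and the identity lift `p`, and they agree at `a`.
    hp.eq_of_comp_eq (g.continuous.comp f.continuous) continuous_id
      (by rw [← Function.comp_assoc, hpg, hpf]; rfl) a (by simp [hf, hg])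
  obtain ⟨f, hf, hpf⟩ := lift hab
  obtain ⟨g, hg, hpg⟩ := lift hab.symm
  exact ⟨⟨⟨⟨f, g, congrFun (inverse hf hpf hg hpg), congrFun (inverse hg hpg hf hpf)⟩,
    f.continuous, g.continuous⟩, congrFun hpf⟩, hf⟩

/-- A universal covering is a quotient covering by its deck group. -/
theorem isQuotientCoveringMap_deckGroup [PreconnectedSpace M] [SimplyConnectedSpace Mhat]
    [LocallyPathConnectedSpace Mhat] (hp : IsCoveringMap p) :
    IsQuotientCoveringMap p (deckGroup p) where
  toIsQuotientMap := hp.isQuotientMap (surjective_of_isCoveringMap hp)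
  continuous_const_smul γ := γ.1.continuous
  apply_eq_iff_mem_orbit {a b} := by
    refine ⟨fun h => exists_deck_apply_eq hp h.symm, ?_⟩
    rintro ⟨γ, rfl⟩
    exact γ.2 b
  disjoint e := by
    obtain ⟨f, he, rfl⟩ := hp.isLocalHomeomorph e
    refine ⟨f.source, f.open_source.mem_nhds he, ?_⟩
    rintro γ ⟨_, ⟨x, hx, rfl⟩, hγx⟩
    -- Since `p` is injective on the chosen sheet, `γ` fixes `x`, and a deck transformation with a
    -- fixed point is trivial.
    have hfix : γ.1 x = x := f.injOn hγx hx (γ.2 x)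
    refine Subtype.ext (Homeomorph.ext (congrFun
      (hp.eq_of_comp_eq γ.1.continuous continuous_id (funext γ.2) x hfix)))

end Deck

section Developing

variable {n : ℕ} {M Mhat : Type*} [TopologicalSpace M] [ChartedSpace (E n) M]
  [TopologicalSpace Mhat] {p : Mhat → M} {D : Mhat → E n}

theorem IsDevelopingMap.isOpenEmbedding (hp : IsCoveringMap p) (hD : IsDevelopingMap p D)
    (hinj : Function.Injective D) : IsOpenEmbedding D :=
  .of_continuous_injective_isOpenMap
    (continuous_iff_continuousAt.2 fun x => (hD.map_nhds hp x).le) hinj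
    (IsOpenMap.of_nhds_le fun x => (hD.map_nhds hp x).ge)

end Developing

/-! ### Paths and loops in leaves -/

namespace LinearFoliation

variable {n : ℕ} {M Mhat : Type*} [TopologicalSpace M] [ChartedSpace (E n) M]
  [TopologicalSpace Mhat] [ConnectedSpace Mhat] {p : Mhat → M} {D : Mhat → E n}
  {hp : IsCoveringMap p} {hD : IsDevelopingMap p D} (F : LinearFoliation hp hD)

theorem nhds_coverLeafTopology (x : Mhat) :
    @nhds Mhat F.coverLeafTopology x = 𝓝 x ⊓ 𝓟 {y | F.U.mkQ (D y) = F.U.mkQ (D x)} :=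
  nhds_inf_induced_bot _ x

/-- The covering space `M̂`, with its leaf topology. -/
def CoverLeafSpace (_ : LinearFoliation hp hD) : Type _ := Mhat

instance : TopologicalSpace F.CoverLeafSpace := F.coverLeafTopology

/-- The leaf topology on `M̂` refines the topology of `M̂`. -/
def toCover : C(F.CoverLeafSpace, Mhat) :=
  ⟨fun x => x, @continuous_id_of_le Mhat F.coverLeafTopology _ inf_le_left⟩

/-- Nearby points of a leaf are joined in it by the path developed to a segment. -/
theorem eventually_joined (hinj : Function.Injective D) (x : F.CoverLeafSpace) :
    ∀ᶠ y in 𝓝 x, Joined x y := by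
  have hemb := hD.isOpenEmbedding hp hinj
  let dev : F.CoverLeafSpace → E n := D
  obtain ⟨r, hr, hball⟩ := Metric.isOpen_iff.1 hemb.isOpen_range (D x) ⟨x, rfl⟩
  have hnhds := F.nhds_coverLeafTopology x
  have hplaque : ∀ᶠ y in 𝓝 x, dev y ∈ Metric.ball (dev x) r ∧
      F.U.mkQ (dev y) = F.U.mkQ (dev x) := by
    refine Filter.Eventually.and ?_ ?_
    · exact Filter.Eventually.filter_mono (hnhds.le.trans inf_le_left)
        (hemb.continuous.continuousAt.eventually (Metric.ball_mem_nhds _ hr))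
    · exact Filter.Eventually.filter_mono (hnhds.le.trans inf_le_right)
        (eventually_principal.2 fun y hy => hy)
  filter_upwards [hplaque] with y hy
  -- The segment stays in a ball inside the open range of `D`, so it lifts through `D`.
  have hseg (t : unitInterval) : ∃ z : Mhat, D z = AffineMap.lineMap (dev x) (dev y) (t : ℝ) :=
    hball ((convex_ball (D x) r).segment_subset (Metric.mem_ball_self hr) hy.1
      (segment_eq_image_lineMap ℝ (dev x) (dev y) ▸ ⟨t, t.2, rfl⟩))
  choose c hc using hseg
  have hcU (t : unitInterval) : F.U.mkQ (D (c t)) = F.U.mkQ (dev x) := by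
    rw [hc, AffineMap.lineMap_apply, vsub_eq_sub, vadd_eq_add, map_add, map_smul, map_sub, hy.2,
      sub_self, smul_zero, zero_add]
  -- Leaf continuity is continuity in `Mhat` plus that of the transverse coordinate, constant along
  -- `c`.
  have hcont : Continuous[_, F.coverLeafTopology] c := by
    refine continuous_inf_rng.2 ⟨hemb.isInducing.continuous_iff.2 ?_, continuous_induced_rng.2 ?_⟩
    · refine Continuous.congr ?_ fun t => (hc t).symm
      exact AffineMap.lineMap_continuous.comp continuous_subtype_val
    · exact @continuous_of_const _ _ _ ⊥ _ fun s t => (hcU s).trans (hcU t).symm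
  exact ⟨⟨⟨c, hcont⟩, hinj (by rw [hc]; simp [dev]), hinj (by rw [hc]; simp [dev])⟩⟩

variable {F}

/-- Two points of a leaf of `M̂` are joined by a path for the leaf topology. -/
theorem IsCoverLeaf.joined {L : Set Mhat} (hL : F.IsCoverLeaf L) (hinj : Function.Injective D)
    {a b : F.CoverLeafSpace} (ha : a ∈ L) (hb : b ∈ L) : Joined a b := by
  obtain ⟨x, rfl⟩ := hL
  have h := connectedComponent_subset_pathComponent (F.eventually_joined hinj) x
  exact (h ha).symm.trans (h hb)

/-- A leaf of `M̂` is stable under paths for the leaf topology. -/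
theorem IsCoverLeaf.mem_of_joined {L : Set Mhat} (hL : F.IsCoverLeaf L)
    {a b : F.CoverLeafSpace} (ha : a ∈ L) (hab : Joined a b) : b ∈ L := by
  obtain ⟨x, rfl⟩ := hL
  have h : connectedComponent a = connectedComponent (α := F.CoverLeafSpace) x :=
    (connectedComponent_eq ha).symm
  exact h ▸ pathComponent_subset_component a hab

variable (F)

theorem continuous_leaf_val (L : Set M) : Continuous fun x : F.Leaf L => (x.1 : M) := by
  have h : F.leafTopology ≤ (inferInstance : TopologicalSpace M) :=
    continuous_iff_coinduced_le.1 (continuous_inf_dom_left hp.continuous)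
  exact continuous_le_rng h continuous_induced_dom

/-- The inclusion of a leaf of `M`. -/
def leafInclusion (L : Set M) : C(F.Leaf L, M) := ⟨fun x => x.1, F.continuous_leaf_val L⟩

/-- The projection to `M` of a path in a leaf of `M̂` is a path in the leaf below. -/
theorem exists_leaf_path {L : Set Mhat} (hL : F.IsCoverLeaf L) {a b : F.CoverLeafSpace}
    (ha : a ∈ L) (γ : Path a b) {y z : F.Leaf (p '' L)} (hy : p a = y.1) (hz : p b = z.1) :
    ∃ δ : Path y z, ∀ t, (δ t).1 = p (γ t) := by
  -- The part of `γ` up to time `t` joins `a` to `γ t` in the leaf topology.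
  have hmem (t : unitInterval) : γ t ∈ L :=
    hL.mem_of_joined ha ⟨γ.truncateOfLE t.2.1 |>.cast (by simp) (by simp)⟩
  refine ⟨⟨⟨fun t => ⟨p (γ t), γ t, hmem t, rfl⟩, ?_⟩, ?_, ?_⟩, fun t => rfl⟩
  · refine continuous_induced_rng.2 ?_
    exact @Continuous.comp _ Mhat M _ F.coverLeafTopology F.leafTopology γ p
      (@continuous_coinduced_rng _ _ p F.coverLeafTopology) γ.continuous
  · exact Subtype.ext (by simpa using hy)
  · exact Subtype.ext (by simpa using hz)

/-- A deck transformation preserving a leaf of `M̂` comes from a loop in the leaf below. -/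
theorem exists_leaf_loop
    (hinj : Function.Injective D) (hq : IsQuotientCoveringMap p (deckGroup p))
    {L : Set Mhat} (hL : F.IsCoverLeaf L) (y : F.Leaf (p '' L)) (a : Mhat) (ha : a ∈ L)
    (hy : p a = F.leafInclusion (p '' L) y) (γ : deckGroup p) (hγ : γ.1 a ∈ L) :
    ∃ δ : FundamentalGroup (F.Leaf (p '' L)) y,
      hq.fundamentalGroupToMulOpposite ⟨a, hy⟩
        (FundamentalGroup.map (F.leafInclusion (p '' L)) y δ) = MulOpposite.op γ := by
  obtain ⟨η⟩ := hL.joined hinj ha hγ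
  have hy' : p (γ.1 a) = F.leafInclusion (p '' L) y := (γ.2 a).trans hy
  obtain ⟨δ, hδ⟩ := F.exists_leaf_path hL ha η hy hy'
  let ζ : Path (X := Mhat) a (γ.1 a) := η.map F.toCover.continuous
  refine ⟨FundamentalGroup.fromPath (.mk δ), ?_⟩
  -- It suffices that the lift from `a` of the loop ends at `γ a`; that lift is `ζ`.
  refine hq.fundamentalGroupToMulOpposite_apply_eq_Iff.2 ?_
  have hmap : (Path.Homotopic.Quotient.mk ζ).map ⟨p, hp.continuous⟩ =
      ((Path.Homotopic.Quotient.mk δ).map (F.leafInclusion (p '' L))).cast hy hy' := by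
    refine congrArg Path.Homotopic.Quotient.mk (Path.ext (funext fun t => ?_))
    exact (hδ t).symm
  exact (congrArg Subtype.val (hp.monodromy_eq_of_map_eq (ex := ⟨a, hy⟩) (ey := ⟨γ.1 a, hy'⟩)
    (Path.Homotopic.Quotient.mk ζ) hmap)).symm

end LinearFoliation

end AffineFoliation

theorem proposition4p1 {n : ℕ} {M : Type*} [TopologicalSpace M] [ConnectedSpace M]
    [ChartedSpace (AffineFoliation.E n) M] [HasGroupoid M (AffineFoliation.affineGroupoid n)]
    -- the universal covering of `M`
    {Mhat : Type*} [TopologicalSpace Mhat] [SimplyConnectedSpace Mhat]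
    {p : Mhat → M} (hp : IsCoveringMap p)
    -- its injective developing map
    {D : Mhat → AffineFoliation.E n} (hD : AffineFoliation.IsDevelopingMap p D)
    (hinj : Function.Injective D)
    -- the linear foliation of codimension one
    (F : AffineFoliation.LinearFoliation hp hD) (hcodim : F.codim = 1)
    -- a leaf with solvable fundamental group
    (F₀ : Set M) (hF₀ : F.IsLeaf F₀) (x₀ : F.Leaf F₀)
    (hsolv : Group.IsSolvable (FundamentalGroup (F.Leaf F₀) x₀))
    -- a leaf above it which is preserved by the kernel of the global holonomy
    (Fhat₀ : Set Mhat) (hFhat₀ : F.IsCoverLeaf Fhat₀) (habove : p '' Fhat₀ = F₀)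
    (hker : ∀ γ ∈ F.globalHolonomy.ker, γ.1 '' Fhat₀ = Fhat₀) (x : M) :
    Group.IsSolvable (FundamentalGroup M x) := by
  have hemb := hD.isOpenEmbedding hp hinj
  have := hemb.locallyPathConnectedSpace
  have hq := AffineFoliation.isQuotientCoveringMap_deckGroup hp
  have := isSolvable_affineEquiv_of_finrank_eq_one hcodim
  have := isSolvable_mulOpposite ((AffineFoliation.E n ⧸ F.U) ≃ᵃ[ℝ] (AffineFoliation.E n ⧸ F.U))
  subst habove
  obtain ⟨a, ha, hax⟩ := x₀.2
  have hdeck : Group.IsSolvable (AffineFoliation.deckGroup p)ᵐᵒᵖ := by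
    -- Exactness in the middle is not required: the kernel only has to lie in the image of the
    -- leaf's fundamental group.
    refine Group.isSolvable_of_ker_le_range
      ((hq.fundamentalGroupToMulOpposite ⟨a, hax⟩).comp
        (FundamentalGroup.map (F.leafInclusion (p '' Fhat₀)) x₀))
      (MonoidHom.op F.globalHolonomy) fun γ hγ => ?_
    have hγ' : γ.unop ∈ F.globalHolonomy.ker := congrArg MulOpposite.unop hγ
    exact F.exists_leaf_loop hinj hq hFhat₀ x₀ a ha hax γ.unop
      (hker _ hγ' ▸ Set.mem_image_of_mem _ ha)
  -- The base point `x` may lie off the leaf; monodromy is injective at any base point because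
  -- `Mhat` is simply connected.
  obtain ⟨b, hb⟩ := hq.surjective x
  exact Group.isSolvable_of_isSolvable_injective
    (hq.fundamentalGroupToMulOpposite_injective ⟨b, hb⟩)
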